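/- Notation. $R_k$ is the reverse identity matrix of order $k$; a matrix $A\in\mathbb R^{m\times n}$ is centrosymmetric if $R_mAR_n=A$. A (thin) QX factorization of $A\in\mathbb R^{m\times n}$ is $A=QX$, where $Q\in\mathbb R^{m\times n}$ satisfies $Q^TR_mQ=R_n$ and $Q^TQ=I_n$, and $X\in\mathbb R^{n\times n}$ is centrosymmetric and double-cone, i.e. $x_{ij}=0$ whenever $j<i<n+1-j$ or $n+1-j<i<j$. Two matrices $X,Y\in\mathbb R^{n\times n}$ follow the same sign convention if, for every $i$, $x_{i,i}+x_{i,n+1-i}$ and $y_{i,i}+y_{i,n+1-i}$ have the same sign, and $x_{i,i}-x_{i,n+1-i}$ and $y_{i,i}-y_{i,n+1-i}$ have the same sign (signs in $\{-1,0,1\}$). $\|\cdot\|_2$ and $\|\cdot\|_F$ are the spectral and Frobenius norms, $A^\dagger$ is the Moore–Penrose inverse, and $\kappa_2(A)=\|A\|_2\|A^\dagger\|_2$. $\mathbb D_n$ is the set of diagonal centrosymmetric $n\times n$ matrices with positive diagonal entries; for $D=\mathrm{diag}(\delta_1,\delta_2,\dots,\delta_2,\delta_1)\in\mathbb D_n$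 put $\varsigma_D=\max_{1\le\alpha<\beta\le\lceil n/2\rceil}\delta_\beta/\delta_\alpha$ (and $\varsigma_D=0$ if $n\le2$). Theorem 2.1. Let $A\in\mathbb R^{m\times n}$ be a centrosymmetric matrix of full column rank with a QX factorization $A=QX$, and let $\Delta A\in\mathbb R^{m\times n}$ be centrosymmetric. Suppose that $\|\Delta A\,A^\dagger\|_2<1$ and $\|Q^T\Delta A\,X^{-1}\|_F\le\sqrt{3/2}-1$. Then $A+\Delta A$ has a unique QX factorization $$A+\Delta A=(Q+\Delta Q)(X+\Delta X)$$ in which $X+\Delta X$ follows the same sign convention as $X$, and it satisfies $$\|\Delta X\|_F\le(\sqrt6+\sqrt3)\Big(\inf_{D\in\mathbb D_n}\sqrt{1+\varsigma_D^2}\;\kappa_2(D^{-1}X)\Big)\|Q\|_2\|\Delta A\|_F,$$ $$\|\Delta Q\|_F\le(2\sqrt2+2)\Big(\inf_{D\in\mathbb D_n}\|QD^{-1}\|_2\,\|X^{-1}D\|_2\Big)\|Q\|_2\|\Delta A\|_F+(2\sqrt3+\sqrt6)\,\|Q^T\Delta A\,X^{-1}\|_F.$$ -/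

import Mathlib

open scoped Matrix

noncomputable section

namespace QXFactorization

/-- The reverse identity matrix `R_n` (ones on the anti-diagonal, zeros elsewhere). -/
def exchange (n : ℕ) : Matrix (Fin n) (Fin n) ℝ :=
  Matrix.of fun i j => if j = i.rev then 1 else 0

/-- A real `m × n` matrix is centrosymmetric if `R_m A R_n = A`. -/
def IsCentrosymmetric {m n : ℕ} (A : Matrix (Fin m) (Fin n) ℝ) : Prop :=
  exchange m * A * exchange n = A

/-- Column perplectic orthogonal matrices: `Qᵀ R_m Q = R_n` and `Qᵀ Q = I_n`. -/
def IsColumnPerplecticOrthogonal {m n : ℕ} (Q : Matrix (Fin m) (Fin n) ℝ) : Prop :=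
  Qᵀ * exchange m * Q = exchange n ∧ Qᵀ * Q = 1

/-- A square double-cone matrix: in each column, every entry lying strictly between the main
diagonal and the anti-diagonal vanishes, so that the nonzero entries fill an upper and a lower
cone (the shape of the letter X, filled above and below). -/
def IsDoubleCone {n : ℕ} (X : Matrix (Fin n) (Fin n) ℝ) : Prop :=
  ∀ i j : Fin n, (j < i ∧ i < j.rev) ∨ (j.rev < i ∧ i < j) → X i j = 0

/-- `A = Q X` is a (thin) QX factorization: `Q` is column perplectic orthogonal and `X` is a
square double-cone centrosymmetric matrix. -/
def IsQX {m n : ℕ} (A Q : Matrix (Fin m) (Fin n) ℝ) (X : Matrix (Fin n) (Fin n) ℝ) : Prop :=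
  A = Q * X ∧ IsColumnPerplecticOrthogonal Q ∧ IsCentrosymmetric X ∧ IsDoubleCone X

/-- Two square matrices follow the same sign convention: for every `i` the numbers
`x_{i,i} + x_{i,n+1-i}` and `x_{i,i} - x_{i,n+1-i}` have the same signs for both. For a
double-cone centrosymmetric `X` these are the diagonal entries of the two upper triangular
matrices by which `X` acts on the vectors with `R_n v = v` and with `R_n v = -v`; they play the
role of the diagonal of the triangular factor in a QR factorization. -/
def SameSigns {n : ℕ} (X Y : Matrix (Fin n) (Fin n) ℝ) : Prop :=
  ∀ i : Fin n,
    SignType.sign (Y i i + Y i i.rev) = SignType.sign (X i i + X i i.rev) ∧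
    SignType.sign (Y i i - Y i i.rev) = SignType.sign (X i i - X i i.rev)

open scoped Matrix.Norms.L2Operator in
/-- The spectral norm `‖A‖₂`. -/
def norm2 {m n : ℕ} (A : Matrix (Fin m) (Fin n) ℝ) : ℝ := ‖A‖

open scoped Matrix.Norms.Frobenius in
/-- The Frobenius norm `‖A‖_F`. -/
def normF {m n : ℕ} (A : Matrix (Fin m) (Fin n) ℝ) : ℝ := ‖A‖

/-- The four Penrose equations. -/
structure IsMoorePenrose {m n : ℕ} (A : Matrix (Fin m) (Fin n) ℝ)
    (B : Matrix (Fin n) (Fin m) ℝ) : Prop where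
  mul_mul_left : A * B * A = A
  mul_mul_right : B * A * B = B
  symm_left : (A * B)ᵀ = A * B
  symm_right : (B * A)ᵀ = B * A

theorem exists_isMoorePenrose {m n : ℕ} (A : Matrix (Fin m) (Fin n) ℝ) :
    ∃ B, IsMoorePenrose A B := by
  have key : ∃ K : Matrix (Fin n) (Fin n) ℝ, Kᵀ = K ∧ (K * (Aᵀ * A))ᵀ = K * (Aᵀ * A) ∧
      K * (Aᵀ * A) * K = K ∧ (Aᵀ * A) * K * (Aᵀ * A) = Aᵀ * A := by
    have hH : (Aᵀ * A).IsHermitian := by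
      simpa using Matrix.isHermitian_conjTranspose_mul_self A
    generalize Aᵀ * A = H at hH
    set U : Matrix (Fin n) (Fin n) ℝ := hH.eigenvectorUnitary.1 with hU
    set d : Fin n → ℝ := hH.eigenvalues with hd
    have hUU : Uᵀ * U = 1 := by
      have := Unitary.coe_star_mul_self hH.eigenvectorUnitary
      simpa [Matrix.star_eq_conjTranspose] using this
    have hspec : H = U * Matrix.diagonal d * Uᵀ := by
      have h := hH.spectral_theorem
      rw [Unitary.conjStarAlgAut_apply] at h
      simpa [Matrix.star_eq_conjTranspose, Function.comp_def] using h
    have hcomb : ∀ a b : Fin n → ℝ, (U * Matrix.diagonal a * Uᵀ) * (U * Matrix.diagonal b * Uᵀ)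
        = U * Matrix.diagonal (fun i => a i * b i) * Uᵀ := by
      intro a b
      calc _ = U * Matrix.diagonal a * (Uᵀ * U) * Matrix.diagonal b * Uᵀ := by
            simp only [Matrix.mul_assoc]
        _ = _ := by rw [hUU, Matrix.mul_one, Matrix.mul_assoc U, Matrix.diagonal_mul_diagonal]
    have htr : ∀ a : Fin n → ℝ, (U * Matrix.diagonal a * Uᵀ)ᵀ = U * Matrix.diagonal a * Uᵀ := by
      intro a
      simp [Matrix.transpose_mul, Matrix.mul_assoc]
    refine ⟨U * Matrix.diagonal (fun i => (d i)⁻¹) * Uᵀ, htr _, ?_, ?_, ?_⟩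
    · rw [hspec, hcomb, htr]
    · rw [hspec, hcomb, hcomb]
      congr 3
      funext i
      by_cases h : d i = 0 <;> simp [h]
    · rw [hspec, hcomb, hcomb]
      congr 3
      funext i
      by_cases h : d i = 0 <;> simp [h]
  obtain ⟨K, hK, hs, h1, h2⟩ := key
  refine ⟨K * Aᵀ, ?_, ?_, ?_, ?_⟩
  · have hs' : Aᵀ * (A * K) = K * (Aᵀ * A) := by
      rw [← hs]
      simp [Matrix.transpose_mul, hK, Matrix.mul_assoc]
    have h0 : (A * (K * Aᵀ) * A - A)ᵀ * (A * (K * Aᵀ) * A - A) = 0 := by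
      have e : Aᵀ * (A * (K * Aᵀ) * A - A) = 0 := by
        rw [Matrix.mul_sub, sub_eq_zero]
        simpa only [Matrix.mul_assoc] using h2
      have e' : (A * (K * Aᵀ) * A - A)ᵀ = (K * (Aᵀ * A) - 1)ᵀ * Aᵀ := by
        rw [← Matrix.transpose_mul]
        congr 1
        simp only [Matrix.mul_sub, Matrix.mul_one, Matrix.mul_assoc]
      rw [e', Matrix.mul_assoc, e, Matrix.mul_zero]
    have h3 : A * (K * Aᵀ) * A - A = 0 := by
      apply Matrix.conjTranspose_mul_self_eq_zero.mp
      simpa [Matrix.conjTranspose_eq_transpose_of_trivial] using h0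
    exact sub_eq_zero.mp h3
  · calc K * Aᵀ * A * (K * Aᵀ) = (K * (Aᵀ * A) * K) * Aᵀ := by simp only [Matrix.mul_assoc]
      _ = K * Aᵀ := by rw [h1]
  · simp [Matrix.transpose_mul, hK, Matrix.mul_assoc]
  · rw [Matrix.mul_assoc K]
    exact hs

/-- The Moore–Penrose inverse `A†`, the (unique) solution of the four Penrose equations. -/
def pinv {m n : ℕ} (A : Matrix (Fin m) (Fin n) ℝ) : Matrix (Fin n) (Fin m) ℝ :=
  (exists_isMoorePenrose A).choose

theorem pinv_spec {m n : ℕ} (A : Matrix (Fin m) (Fin n) ℝ) : IsMoorePenrose A (pinv A) :=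
  (exists_isMoorePenrose A).choose_spec

theorem IsMoorePenrose.unique {m n : ℕ} {A : Matrix (Fin m) (Fin n) ℝ}
    {B C : Matrix (Fin n) (Fin m) ℝ} (hB : IsMoorePenrose A B) (hC : IsMoorePenrose A C) :
    B = C := by
  have e1 : A * B = A * C := by
    calc A * B = (A * C) * (A * B) := by
          rw [← Matrix.mul_assoc, hC.mul_mul_left]
      _ = ((A * B) * (A * C))ᵀ := by rw [Matrix.transpose_mul, hB.symm_left, hC.symm_left]
      _ = A * C := by rw [← Matrix.mul_assoc, hB.mul_mul_left, hC.symm_left]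
  have e2 : B * A = C * A := by
    calc B * A = (B * A) * (C * A) := by
          rw [Matrix.mul_assoc B, ← Matrix.mul_assoc A, hC.mul_mul_left]
      _ = ((C * A) * (B * A))ᵀ := by rw [Matrix.transpose_mul, hB.symm_right, hC.symm_right]
      _ = C * A := by
          rw [Matrix.mul_assoc C, ← Matrix.mul_assoc A, hB.mul_mul_left, hC.symm_right]
  rw [← hB.mul_mul_right, e2, Matrix.mul_assoc, e1, ← Matrix.mul_assoc, hC.mul_mul_right]

/-- The spectral condition number `κ₂(A) = ‖A‖₂ ‖A†‖₂`. -/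
def kappa2 {m n : ℕ} (A : Matrix (Fin m) (Fin n) ℝ) : ℝ := norm2 A * norm2 (pinv A)

/-- The set `𝔻_n` of diagonal centrosymmetric matrices with positive diagonal entries, that is
`diag(δ₁, δ₂, …, δ₂, δ₁)` with all `δ_α > 0`. -/
def PosDiag (n : ℕ) : Set (Matrix (Fin n) (Fin n) ℝ) :=
  {D | D.IsDiag ∧ IsCentrosymmetric D ∧ ∀ i, 0 < D i i}

/-- `ς_D = max_{α < β} δ_β / δ_α` for `D = diag(δ₁, δ₂, …, δ₂, δ₁)`, where `α < β` run over the
indices of the list `δ₁, δ₂, …` of parameters, i.e. over the first half of the diagonal (with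
the middle position if `n` is odd). It is `0` if there is only one parameter. -/
def varsigma {n : ℕ} (D : Matrix (Fin n) (Fin n) ℝ) : ℝ :=
  sSup {r : ℝ | ∃ a b : Fin n, a < b ∧ b ≤ b.rev ∧ r = D b b / D a a}

end QXFactorization

end

/-! Since `X` is invertible, `A + ΔA = (Q + K) X` with `K = ΔA X⁻¹`. It therefore suffices to
orthonormalize the columns of `Q + K`. Its Gram matrix is `1 + G + Gᵀ + Kᵀ K` with `G = Qᵀ K`. It is
centrosymmetric, and positive definite because `‖G‖₂ < 1`. If it equals `Lᵀ L` with `L`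
centrosymmetric and double-cone, then `A + ΔA = ((Q + K) L⁻¹) (L X)` is the desired factorization.

The factor `L` is a Cholesky factor in disguise. In a basis of eigenvectors of the exchange matrix,
ordered so that each pair of mirror positions is adjacent, centrosymmetric double-cone matrices
become upper triangular, with diagonal entries `x_{i,i} ± x_{i,n+1-i}` (just `x_{i,i}` at a middle
position). Existence and uniqueness thus come from Cholesky factorization
(`exists_isDoubleCone_factor`, `isDoubleCone_factor_unique`).

For the bounds, `ΔX = (L - 1) X` and `ΔQ = (K - Q (L - 1)) L⁻¹`, so everything rests on `L - 1`.
From `L - L⁻ᵀ = L⁻ᵀ (G + Gᵀ + Kᵀ K)`, where `L⁻ᵀ` is lower triangular, the upper triangle of the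
right side dominates `L - 1` entrywise (`abs_cholesky_sub_one_le`). A column scaling `D` passes
through this estimate at the cost of ratios `δ_β / δ_α` in one direction only, which is how `ς_D`
enters (`normF_factor_sub_one_mul_diagonal_le`). Finally `‖L⁻¹‖₂ ≤ 1 / (1 - ‖G‖₂)` by
`norm2_inv_le`. -/

noncomputable section

namespace QXFactorization

variable {l m n : ℕ}

/-! ### Spectral and Frobenius norms. -/

section Norms

theorem norm2_nonneg (A : Matrix (Fin m) (Fin n) ℝ) : 0 ≤ norm2 A := by
  let := Matrix.instL2OpNormedAddCommGroup (m := Fin m) (n := Fin n) (𝕜 := ℝ)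
  exact norm_nonneg A

theorem norm2_mul_le (A : Matrix (Fin l) (Fin m) ℝ) (B : Matrix (Fin m) (Fin n) ℝ) :
    norm2 (A * B) ≤ norm2 A * norm2 B :=
  Matrix.l2_opNorm_mul A B

theorem norm2_sub_le (A B : Matrix (Fin m) (Fin n) ℝ) : norm2 (A - B) ≤ norm2 A + norm2 B := by
  let := Matrix.instL2OpNormedAddCommGroup (m := Fin m) (n := Fin n) (𝕜 := ℝ)
  exact norm_sub_le A B

theorem norm2_transpose (A : Matrix (Fin m) (Fin n) ℝ) : norm2 Aᵀ = norm2 A := by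
  have := Matrix.l2_opNorm_conjTranspose A
  rwa [Matrix.conjTranspose_eq_transpose_of_trivial] at this

theorem norm2_transpose_mul_self (A : Matrix (Fin m) (Fin n) ℝ) :
    norm2 (Aᵀ * A) = norm2 A * norm2 A := by
  have := Matrix.l2_opNorm_conjTranspose_mul_self A
  rwa [Matrix.conjTranspose_eq_transpose_of_trivial] at this

/-- Equality fails for `n = 0`, where the norm is zero. -/
theorem norm2_one_le : norm2 (1 : Matrix (Fin n) (Fin n) ℝ) ≤ 1 := by
  have h := norm2_transpose_mul_self (1 : Matrix (Fin n) (Fin n) ℝ)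
  rw [Matrix.transpose_one, Matrix.one_mul] at h
  nlinarith [norm2_nonneg (1 : Matrix (Fin n) (Fin n) ℝ)]

theorem norm2_le_one_of_transpose_mul_self {Q : Matrix (Fin m) (Fin n) ℝ} (hQ : Qᵀ * Q = 1) :
    norm2 Q ≤ 1 := by
  have h := norm2_transpose_mul_self Q
  rw [hQ] at h
  nlinarith [norm2_nonneg Q, norm2_one_le (n := n)]

theorem normF_nonneg (A : Matrix (Fin m) (Fin n) ℝ) : 0 ≤ normF A := by
  let := Matrix.frobeniusNormedAddCommGroup (m := Fin m) (n := Fin n) (α := ℝ)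
  exact norm_nonneg A

theorem normF_add_le (A B : Matrix (Fin m) (Fin n) ℝ) : normF (A + B) ≤ normF A + normF B := by
  let := Matrix.frobeniusNormedAddCommGroup (m := Fin m) (n := Fin n) (α := ℝ)
  exact norm_add_le A B

theorem normF_sub_le (A B : Matrix (Fin m) (Fin n) ℝ) : normF (A - B) ≤ normF A + normF B := by
  let := Matrix.frobeniusNormedAddCommGroup (m := Fin m) (n := Fin n) (α := ℝ)
  exact norm_sub_le A B

theorem normF_transpose (A : Matrix (Fin m) (Fin n) ℝ) : normF Aᵀ = normF A :=
  Matrix.frobenius_norm_transpose A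

theorem normF_smul {c : ℝ} (hc : 0 ≤ c) (A : Matrix (Fin m) (Fin n) ℝ) :
    normF (c • A) = c * normF A := by
  let := Matrix.frobeniusNormedAddCommGroup (m := Fin m) (n := Fin n) (α := ℝ)
  let := Matrix.frobeniusNormedSpace (R := ℝ) (m := Fin m) (n := Fin n) (α := ℝ)
  have := norm_smul c A
  rwa [Real.norm_of_nonneg hc] at this

theorem normF_sq (A : Matrix (Fin m) (Fin n) ℝ) : normF A ^ 2 = ∑ j, ∑ i, A i j ^ 2 := by
  have h : normF A = (∑ i, ∑ j, ‖A i j‖ ^ (2 : ℝ)) ^ (1 / 2 : ℝ) := Matrix.frobenius_norm_def A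
  rw [h, ← Real.sqrt_eq_rpow, Real.sq_sqrt (by positivity), Finset.sum_comm]
  simp

theorem normF_le_of_abs_le {A B : Matrix (Fin m) (Fin n) ℝ} (h : ∀ i j, |A i j| ≤ |B i j|) :
    normF A ≤ normF B := by
  refine le_of_sq_le_sq ?_ (normF_nonneg B)
  rw [normF_sq, normF_sq]
  exact Finset.sum_le_sum fun j _ => Finset.sum_le_sum fun i _ => sq_le_sq.2 (h i j)

theorem sum_mulVec_sq_le (A : Matrix (Fin m) (Fin n) ℝ) (v : Fin n → ℝ) :
    ∑ i, (A *ᵥ v) i ^ 2 ≤ norm2 A ^ 2 * ∑ i, v i ^ 2 := by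
  have h := Matrix.l2_opNorm_mulVec A (WithLp.toLp 2 v)
  have h2 := pow_le_pow_left₀ (norm_nonneg _) h 2
  rw [mul_pow, EuclideanSpace.norm_sq_eq, EuclideanSpace.norm_sq_eq] at h2
  simp only [Real.norm_eq_abs, sq_abs] at h2
  exact h2

theorem normF_mul_le (A : Matrix (Fin l) (Fin m) ℝ) (B : Matrix (Fin m) (Fin n) ℝ) :
    normF (A * B) ≤ norm2 A * normF B := by
  refine le_of_sq_le_sq ?_ (mul_nonneg (norm2_nonneg A) (normF_nonneg B))
  rw [mul_pow, normF_sq, normF_sq, Finset.mul_sum]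
  refine Finset.sum_le_sum fun j _ => ?_
  exact sum_mulVec_sq_le A fun i => B i j

theorem normF_mul_le' (A : Matrix (Fin l) (Fin m) ℝ) (B : Matrix (Fin m) (Fin n) ℝ) :
    normF (A * B) ≤ normF A * norm2 B := by
  rw [← normF_transpose, Matrix.transpose_mul, mul_comm, ← normF_transpose A, ← norm2_transpose B]
  exact normF_mul_le _ _

theorem norm2_le_normF (A : Matrix (Fin m) (Fin n) ℝ) : norm2 A ≤ normF A := by
  refine ContinuousLinearMap.opNorm_le_bound _ (normF_nonneg A) fun v => ?_
  refine le_of_sq_le_sq ?_ (mul_nonneg (normF_nonneg A) (norm_nonneg v))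
  rw [mul_pow, normF_sq, Finset.sum_comm, EuclideanSpace.norm_sq_eq, EuclideanSpace.norm_sq_eq,
    Finset.sum_mul]
  refine Finset.sum_le_sum fun i _ => ?_
  have : ∑ j, ‖v j‖ ^ 2 = ∑ j, v j ^ 2 := by simp
  rw [this, Real.norm_eq_abs, sq_abs]
  exact Finset.sum_mul_sq_le_sq_mul_sq Finset.univ (fun j => A i j) fun j => v j

theorem normF_mul_le_normF {Q : Matrix (Fin l) (Fin m) ℝ} (hQ : norm2 Q ≤ 1)
    (B : Matrix (Fin m) (Fin n) ℝ) : normF (Q * B) ≤ normF B :=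
  (normF_mul_le Q B).trans (mul_le_of_le_one_left (normF_nonneg B) hQ)

theorem normF_mul_le_normF' {Q : Matrix (Fin m) (Fin n) ℝ} (hQ : norm2 Q ≤ 1)
    (B : Matrix (Fin l) (Fin m) ℝ) : normF (B * Q) ≤ normF B :=
  (normF_mul_le' B Q).trans (mul_le_of_le_one_right (normF_nonneg B) hQ)

end Norms

/-! ### Triangular matrices with respect to an injective key, and Cholesky factors. -/

section Triangular

open Matrix

variable {ι : Type*} [Fintype ι] {b : ι → ℕ}

theorem BlockTriangular.mul_apply_self (hb : Function.Injective b) {X Y : Matrix ι ι ℝ}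
    (hX : X.BlockTriangular b) (hY : Y.BlockTriangular b) (i : ι) :
    (X * Y) i i = X i i * Y i i := by
  rw [Matrix.mul_apply, Finset.sum_eq_single i _ (by simp)]
  intro k _ hk
  rcases lt_or_gt_of_ne (hb.ne hk) with h | h
  · rw [hX h, zero_mul]
  · rw [hY h, mul_zero]

variable [DecidableEq ι]

theorem _root_.Matrix.BlockTriangular.inv_of_isUnit {X : Matrix ι ι ℝ} (hX : X.BlockTriangular b)
    (hu : IsUnit X) : X⁻¹.BlockTriangular b := by
  let := hu.invertible
  exact blockTriangular_inv_of_blockTriangular hX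

theorem BlockTriangular.diag_mul_inv (hb : Function.Injective b) {X : Matrix ι ι ℝ}
    (hX : X.BlockTriangular b) (hu : IsUnit X) (i : ι) : X i i * X⁻¹ i i = 1 := by
  rw [← BlockTriangular.mul_apply_self hb hX (hX.inv_of_isUnit hu),
    Matrix.mul_nonsing_inv _ ((Matrix.isUnit_iff_isUnit_det _).1 hu), Matrix.one_apply_eq]

/-- The square roots of the diagonal entries of the LDL decomposition are absorbed into the
triangular factor. -/
theorem exists_cholesky_of_linearOrder {κ : Type*} [Fintype κ] [LinearOrder κ]
    {S : Matrix κ κ ℝ} (hS : S.PosDef) :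
    ∃ L : Matrix κ κ ℝ, (∀ i j, j < i → L i j = 0) ∧ Lᵀ * L = S := by
  let : LocallyFiniteOrderBot κ :=
    LocallyFiniteOrderBot.ofIic κ (fun a => Finset.univ.filter (· ≤ a)) (by simp)
  have hT : (LDL.lowerInv hS)ᵀ.BlockTriangular id := fun i j h => LDL.lowerInv_triangular hS h
  have hM : (LDL.lower hS)ᵀ.BlockTriangular id := by
    rw [LDL.lower, Matrix.transpose_nonsing_inv]
    exact blockTriangular_inv_of_blockTriangular hT
  have hd : ∀ i, 0 ≤ LDL.diagEntries hS i := by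
    intro i
    have h := hS.posSemidef.dotProduct_mulVec_nonneg (star (LDL.lowerInv hS i))
    rwa [LDL.diagEntries, EuclideanSpace.inner_toLp_toLp, dotProduct_comm]
  refine ⟨diagonal (fun i => √(LDL.diagEntries hS i)) * (LDL.lower hS)ᵀ, ?_, ?_⟩
  · intro i j h
    rw [diagonal_mul, hM h, mul_zero]
  · have h := LDL.lower_conj_diag hS
    rw [Matrix.conjTranspose_eq_transpose_of_trivial] at h
    conv_rhs => rw [← h]
    rw [transpose_mul, diagonal_transpose, transpose_transpose, Matrix.mul_assoc,
      ← Matrix.mul_assoc (diagonal _) (diagonal _), diagonal_mul_diagonal, ← Matrix.mul_assoc]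
    simp only [Real.mul_self_sqrt (hd _)]
    rfl

/-- Cholesky factorization with respect to the order of the indices given by an injective key. -/
theorem exists_cholesky (hb : Function.Injective b) {S : Matrix ι ι ℝ} (hS : S.PosDef) :
    ∃ L : Matrix ι ι ℝ, L.BlockTriangular b ∧ (∀ i, 0 < L i i) ∧ Lᵀ * L = S := by
  let e : Set.range b ≃ ι := (Equiv.ofInjective b hb).symm
  have he : ∀ i, ((e.symm i : Set.range b) : ℕ) = b i := fun i => rfl
  obtain ⟨M, hM, hMS⟩ := exists_cholesky_of_linearOrder (hS.submatrix e.injective)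
  set N : Matrix ι ι ℝ := M.submatrix e.symm e.symm with hN
  have hNb : N.BlockTriangular b := fun i j h => hM _ _ h
  have hNS : Nᵀ * N = S := by
    rw [hN, transpose_submatrix, submatrix_mul_equiv, hMS]
    simp
  have hu : IsUnit N := by
    have h1 := hS.isUnit
    rw [← hNS, Matrix.isUnit_iff_isUnit_det, det_mul] at h1
    exact (Matrix.isUnit_iff_isUnit_det _).2 (isUnit_of_mul_isUnit_right h1)
  have h0 : ∀ i, N i i ≠ 0 := fun i h => by
    have := BlockTriangular.diag_mul_inv hb hNb hu i
    simp [h] at this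
  -- Multiplying the rows by the signs of the diagonal makes the diagonal positive. The Gram matrix
  -- is unchanged because the signs square to one.
  have hs : ∀ i, SignType.sign (N i i) * (SignType.sign (N i i) : ℝ) = 1 := by
    intro i
    rcases lt_or_gt_of_ne (h0 i) with h | h
    · simp [sign_neg h]
    · simp [sign_pos h]
  refine ⟨diagonal (fun i => (SignType.sign (N i i) : ℝ)) * N,
    (blockTriangular_diagonal _).mul hNb, fun i => ?_, ?_⟩
  · rw [diagonal_mul, sign_mul_self]
    exact abs_pos.2 (h0 i)
  · rw [transpose_mul, diagonal_transpose, Matrix.mul_assoc,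
      ← Matrix.mul_assoc (diagonal _) (diagonal _), diagonal_mul_diagonal]
    simp only [hs]
    rw [diagonal_one, Matrix.one_mul, hNS]

theorem isUnit_of_transpose_mul_self {L S : Matrix ι ι ℝ} (hS : IsUnit S) (h : Lᵀ * L = S) :
    IsUnit L := by
  rw [← h, Matrix.isUnit_iff_isUnit_det, det_mul] at hS
  exact (Matrix.isUnit_iff_isUnit_det _).2 (isUnit_of_mul_isUnit_right hS)

/-- The Cholesky factor of `1 + H` differs from the identity, entry by entry, by at most the upper
triangle of `L⁻ᵀ H`. -/
theorem abs_cholesky_sub_one_le (hb : Function.Injective b) {L H : Matrix ι ι ℝ}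
    (hL : L.BlockTriangular b) (hpos : ∀ i, 0 < L i i) (hu : IsUnit L) (hLH : Lᵀ * L = 1 + H)
    {i j : ι} (hij : b i ≤ b j) : |(L - 1) i j| ≤ |(L⁻¹ᵀ * H) i j| := by
  have hdet := (Matrix.isUnit_iff_isUnit_det _).1 hu
  -- The Gram equation multiplied by `L⁻ᵀ`. Strictly above the diagonal `L⁻ᵀ` vanishes, so there the
  -- right side is just `L`.
  have e : L⁻¹ᵀ * H = L - L⁻¹ᵀ := by
    have h1 : L⁻¹ᵀ * (Lᵀ * L) = L := by
      rw [← Matrix.mul_assoc, ← transpose_mul, mul_nonsing_inv _ hdet, transpose_one,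
        Matrix.one_mul]
    rw [hLH, Matrix.mul_add, Matrix.mul_one] at h1
    exact eq_sub_of_add_eq' h1
  rw [e]
  rcases hij.lt_or_eq with h | h
  · have hne : i ≠ j := fun h' => h.ne (congrArg b h')
    have h0 : L⁻¹ j i = 0 := hL.inv_of_isUnit hu h
    simp [hne, h0]
  · obtain rfl := hb h
    have h1 := BlockTriangular.diag_mul_inv hb hL hu i
    have hp := hpos i
    have h2 : L⁻¹ i i = (L i i)⁻¹ := eq_inv_of_mul_eq_one_right h1
    rw [Matrix.sub_apply, Matrix.sub_apply, Matrix.one_apply_eq, transpose_apply, h2]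
    -- On the diagonal `|l - 1| ≤ |l - l⁻¹|`, since the second factor here is at least one.
    have h3 : L i i - (L i i)⁻¹ = (L i i - 1) * (1 + (L i i)⁻¹) := by
      field_simp
      ring
    rw [h3, abs_mul]
    refine le_mul_of_one_le_right (abs_nonneg _) (le_trans ?_ (le_abs_self _))
    have := inv_pos.2 hp
    linarith

/-- The case `H = 0` of the entrywise bound. -/
theorem eq_one_of_cholesky (hb : Function.Injective b) {L : Matrix ι ι ℝ}
    (hL : L.BlockTriangular b) (hpos : ∀ i, 0 < L i i) (h : Lᵀ * L = 1) : L = 1 := by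
  have hu : IsUnit L := isUnit_of_transpose_mul_self isUnit_one h
  ext i j
  rcases lt_or_ge (b j) (b i) with hij | hij
  · rw [hL hij, Matrix.one_apply_ne]
    rintro rfl
    exact lt_irrefl _ hij
  · have := abs_cholesky_sub_one_le hb hL hpos hu (H := 0) (by rw [h, add_zero]) hij
    rw [Matrix.mul_zero, Matrix.zero_apply, abs_zero, abs_nonpos_iff, Matrix.sub_apply] at this
    linarith

/-- Triangular factors of the same Gram matrix whose diagonals have the same signs agree. -/
theorem cholesky_unique (hb : Function.Injective b) {L M : Matrix ι ι ℝ}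
    (hL : L.BlockTriangular b) (hM : M.BlockTriangular b) (hu : IsUnit M)
    (hs : ∀ i, SignType.sign (L i i) = SignType.sign (M i i)) (h : Lᵀ * L = Mᵀ * M) : L = M := by
  have hdet := (Matrix.isUnit_iff_isUnit_det _).1 hu
  have hMi := hM.inv_of_isUnit hu
  -- The quotient is triangular and orthogonal, and its diagonal is positive because the signs
  -- agree.
  have h1 : L * M⁻¹ = 1 := by
    refine eq_one_of_cholesky hb (hL.mul hMi) (fun i => ?_) ?_
    · rw [BlockTriangular.mul_apply_self hb hL hMi]
      have h2 := BlockTriangular.diag_mul_inv hb hM hu i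
      rw [← sign_eq_one_iff, sign_mul, hs i, ← sign_mul, h2, sign_one]
    · rw [transpose_mul, Matrix.mul_assoc, ← Matrix.mul_assoc Lᵀ, h, Matrix.mul_assoc,
        mul_nonsing_inv _ hdet, Matrix.mul_one, ← transpose_mul, mul_nonsing_inv _ hdet,
        transpose_one]
  calc L = L * M⁻¹ * M := by rw [Matrix.mul_assoc, nonsing_inv_mul _ hdet, Matrix.mul_one]
    _ = M := by rw [h1, Matrix.one_mul]

end Triangular

/-! ### Perturbation of the Cholesky factor under column scaling. -/

open Matrix

/-- Perturbation bound for the Cholesky factor of `1 + G + Gᵀ + Kᵀ K`, with column scaling. -/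
theorem normF_cholesky_sub_one_mul_diagonal_le {b : Fin n → ℕ} (hb : Function.Injective b)
    {L G : Matrix (Fin n) (Fin n) ℝ} {K : Matrix (Fin m) (Fin n) ℝ}
    (hL : L.BlockTriangular b) (hpos : ∀ i, 0 < L i i) (hu : IsUnit L)
    (hLH : Lᵀ * L = 1 + (G + Gᵀ + Kᵀ * K)) (hK : norm2 K ≤ 1) {d : Fin n → ℝ}
    (hd0 : ∀ i, 0 ≤ d i) {c : ℝ} (hc : 0 ≤ c) (hd : ∀ i j, b i ≤ b j → d j ≤ c * d i) :
    normF ((L - 1) * diagonal d) ≤ norm2 L⁻¹ *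
      (normF (G * diagonal d) + c * normF (G * diagonal d) + normF (K * diagonal d)) := by
  -- `M` is `Gᵀ * diagonal d` cut down to `b k ≤ b j`. The cut is harmless: as `L⁻ᵀ` is lower
  -- triangular, an entry `(i, j)` of the product with `b i ≤ b j` only meets rows `k` with `b k ≤ b
  -- i`. On the part that is kept, `d j ≤ c * d k` bounds `M` by `c` times the transpose of `G *
  -- diagonal d`.
  set M : Matrix (Fin n) (Fin n) ℝ := of fun k j => if b k ≤ b j then G j k * d j else 0 with hM
  have hMn : normF M ≤ c * normF (G * diagonal d) := by
    rw [← normF_transpose (G * diagonal d), ← normF_smul hc]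
    refine normF_le_of_abs_le fun k j => ?_
    rw [Matrix.smul_apply, transpose_apply, mul_diagonal, hM, of_apply, smul_eq_mul]
    split_ifs with h
    · rw [abs_mul, abs_mul, abs_mul, abs_of_nonneg (hd0 j), abs_of_nonneg (hd0 k),
        abs_of_nonneg hc]
      nlinarith [mul_le_mul_of_nonneg_left (hd k j h) (abs_nonneg (G j k))]
    · rw [abs_zero]
      exact abs_nonneg _
  have hle : normF ((L - 1) * diagonal d) ≤
      normF (L⁻¹ᵀ * (G * diagonal d + M + Kᵀ * (K * diagonal d))) := by
    refine normF_le_of_abs_le fun i j => ?_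
    rcases lt_or_ge (b j) (b i) with hij | hij
    · have hne : i ≠ j := by
        rintro rfl
        exact lt_irrefl _ hij
      rw [mul_diagonal, Matrix.sub_apply, hL hij, Matrix.one_apply_ne hne, sub_zero, zero_mul,
        abs_zero]
      exact abs_nonneg _
    · have e : (L⁻¹ᵀ * (G * diagonal d + M + Kᵀ * (K * diagonal d))) i j =
          (L⁻¹ᵀ * (G + Gᵀ + Kᵀ * K)) i j * d j := by
        rw [← mul_diagonal, Matrix.mul_assoc, Matrix.add_mul, Matrix.add_mul, Matrix.mul_assoc Kᵀ,
          Matrix.mul_add, Matrix.mul_add, Matrix.mul_add, Matrix.mul_add, Matrix.add_apply,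
          Matrix.add_apply, Matrix.add_apply, Matrix.add_apply]
        congr 2
        rw [Matrix.mul_apply, Matrix.mul_apply]
        refine Finset.sum_congr rfl fun k _ => ?_
        rcases lt_or_ge (b i) (b k) with hik | hik
        · rw [transpose_apply, hL.inv_of_isUnit hu hik, zero_mul, zero_mul]
        · rw [hM, of_apply, if_pos (hik.trans hij), mul_diagonal, transpose_apply G]
      rw [e, mul_diagonal, abs_mul, abs_mul]
      exact mul_le_mul_of_nonneg_right (abs_cholesky_sub_one_le hb hL hpos hu hLH hij)
        (abs_nonneg _)
  refine hle.trans ((normF_mul_le _ _).trans ?_)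
  rw [norm2_transpose]
  refine mul_le_mul_of_nonneg_left ?_ (norm2_nonneg _)
  refine (normF_add_le _ _).trans (add_le_add ((normF_add_le _ _).trans (add_le_add le_rfl hMn)) ?_)
  exact normF_mul_le_normF (by rwa [norm2_transpose]) _

/-! ### The exchange matrix, its eigenbasis, and double-cone matrices as triangular ones. -/

section Exchange

theorem exchange_apply (i j : Fin n) : exchange n i j = if i = j.rev then 1 else 0 := by
  rw [exchange, of_apply]
  exact if_congr ⟨fun h => by rw [h, Fin.rev_rev], fun h => by rw [h, Fin.rev_rev]⟩ rfl rfl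

theorem exchange_mul_apply (M : Matrix (Fin m) (Fin n) ℝ) (i : Fin m) (j : Fin n) :
    (exchange m * M) i j = M i.rev j := by
  simp [Matrix.mul_apply, exchange]

theorem mul_exchange_apply (M : Matrix (Fin m) (Fin n) ℝ) (i : Fin m) (j : Fin n) :
    (M * exchange n) i j = M i j.rev := by
  have : ∀ k : Fin n, j = k.rev ↔ j.rev = k := fun k => by rw [Fin.rev_eq_iff]
  simp [Matrix.mul_apply, exchange, this]

theorem exchange_mul_self : exchange n * exchange n = 1 := by
  ext i j
  rw [exchange_mul_apply, exchange, of_apply, Fin.rev_rev, Matrix.one_apply]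
  simp only [eq_comm]

theorem transpose_exchange : (exchange n)ᵀ = exchange n := by
  ext i j
  rw [transpose_apply, exchange_apply, exchange, of_apply]

theorem isCentrosymmetric_iff {A : Matrix (Fin m) (Fin n) ℝ} :
    IsCentrosymmetric A ↔ exchange m * A = A * exchange n := by
  constructor
  · intro h
    conv_rhs => rw [← h]
    rw [Matrix.mul_assoc _ (exchange n), exchange_mul_self, Matrix.mul_one]
  · intro h
    rw [IsCentrosymmetric, h, Matrix.mul_assoc, exchange_mul_self, Matrix.mul_one]

theorem isCentrosymmetric_iff_apply {A : Matrix (Fin m) (Fin n) ℝ} :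
    IsCentrosymmetric A ↔ ∀ i j, A i.rev j.rev = A i j := by
  rw [IsCentrosymmetric, ← Matrix.ext_iff]
  simp only [mul_exchange_apply, exchange_mul_apply]

theorem IsCentrosymmetric.mul {A : Matrix (Fin l) (Fin m) ℝ} {B : Matrix (Fin m) (Fin n) ℝ}
    (hA : IsCentrosymmetric A) (hB : IsCentrosymmetric B) : IsCentrosymmetric (A * B) := by
  rw [isCentrosymmetric_iff] at *
  rw [← Matrix.mul_assoc, hA, Matrix.mul_assoc, hB, Matrix.mul_assoc]

theorem IsCentrosymmetric.add {A B : Matrix (Fin m) (Fin n) ℝ}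
    (hA : IsCentrosymmetric A) (hB : IsCentrosymmetric B) : IsCentrosymmetric (A + B) := by
  rw [isCentrosymmetric_iff] at *
  rw [Matrix.mul_add, Matrix.add_mul, hA, hB]

theorem IsCentrosymmetric.transpose {A : Matrix (Fin m) (Fin n) ℝ}
    (hA : IsCentrosymmetric A) : IsCentrosymmetric Aᵀ :=
  isCentrosymmetric_iff_apply.2 fun i j => isCentrosymmetric_iff_apply.1 hA j i

theorem IsCentrosymmetric.inv {X : Matrix (Fin n) (Fin n) ℝ}
    (hX : IsCentrosymmetric X) : IsCentrosymmetric X⁻¹ := by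
  have h := congrArg (·⁻¹) hX
  have he : (exchange n)⁻¹ = exchange n := inv_eq_left_inv exchange_mul_self
  simpa only [IsCentrosymmetric, Matrix.mul_inv_rev, he, ← Matrix.mul_assoc] using h

/-- The eigenvalue of `exchange n` for the `i`-th column of `parityBasis n`. -/
def parity (i : Fin n) : ℝ := if i.rev < i then -1 else 1

/-- A symmetric orthogonal matrix of eigenvectors of `exchange n`. -/
def parityBasis (n : ℕ) : Matrix (Fin n) (Fin n) ℝ :=
  of fun i j => if j.rev = j then (if i = j then 1 else 0)
    else (√2)⁻¹ * ((if i = j then parity j else 0) + if i = j.rev then 1 else 0)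

/-- The distance of an index from the nearer end of the list of indices. -/
def level (i : Fin n) : ℕ := min i i.rev

/-- An injective key that refines `level`. -/
def levelKey (i : Fin n) : ℕ := 2 * level i + if i.rev < i then 1 else 0

theorem level_rev (i : Fin n) : level i.rev = level i := by
  simp [level, min_comm]

theorem eq_or_eq_rev_of_level_eq {i j : Fin n} (h : level i = level j) : i = j ∨ i = j.rev := by
  simp only [level, Fin.val_rev, Fin.ext_iff] at *
  omega

theorem levelKey_lt {i j : Fin n} (h : level i < level j) : levelKey i < levelKey j := by
  simp only [levelKey]
  split_ifs <;> omega

theorem levelKey_injective : Function.Injective (levelKey (n := n)) := by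
  intro i j h
  simp only [levelKey, level, Fin.val_rev, Fin.ext_iff, Fin.lt_def] at *
  split_ifs at h <;> omega

theorem parity_mul_self (i : Fin n) : parity i * parity i = 1 := by
  unfold parity
  split_ifs <;> norm_num

theorem parity_rev {i : Fin n} (h : i.rev ≠ i) : parity i.rev = -parity i := by
  simp only [parity, Fin.rev_rev]
  rcases lt_or_gt_of_ne h with h' | h' <;> simp [h', h'.not_gt]

/-- The double-cone shape is block triangularity with blocks formed by the pairs `{i, i.rev}`. -/
theorem isDoubleCone_iff {X : Matrix (Fin n) (Fin n) ℝ} :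
    IsDoubleCone X ↔ X.BlockTriangular level := by
  refine forall₂_congr fun i j => imp_congr ?_ Iff.rfl
  simp only [level, Fin.val_rev, Fin.lt_def]
  omega

theorem mul_parityBasis_apply (M : Matrix (Fin m) (Fin n) ℝ) (i : Fin m) (j : Fin n) :
    (M * parityBasis n) i j =
      if j.rev = j then M i j else (√2)⁻¹ * (parity j * M i j + M i j.rev) := by
  simp only [Matrix.mul_apply, parityBasis, of_apply]
  split_ifs with h
  · simp
  · simp only [mul_add, Finset.sum_add_distrib, mul_ite, mul_zero, Finset.sum_ite_eq',
      Finset.mem_univ, if_true]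
    ring

theorem transpose_parityBasis : (parityBasis n)ᵀ = parityBasis n := by
  ext i j
  simp only [transpose_apply, parityBasis, of_apply]
  by_cases hij : i = j
  · subst hij
    rfl
  · by_cases h : i = j.rev
    · subst h
      simp [hij, Ne.symm hij]
    · have h' : j ≠ i.rev := fun h' => h (by rw [h', Fin.rev_rev])
      simp [hij, h, h', Ne.symm hij]

theorem inv_sqrt_two_mul_self : (√2)⁻¹ * (√2)⁻¹ = (1 / 2 : ℝ) := by
  rw [← mul_inv, Real.mul_self_sqrt (by norm_num)]
  norm_num

theorem parityBasis_mul_self : parityBasis n * parityBasis n = 1 := by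
  ext i j
  rw [mul_parityBasis_apply, Matrix.one_apply]
  by_cases h : j.rev = j
  · simp [parityBasis, h]
  · have h' : ¬ j = j.rev := fun e => h e.symm
    have h2 := inv_sqrt_two_mul_self
    have h3 := parity_mul_self j
    simp only [parityBasis, of_apply, h, h', Fin.rev_rev, if_false, parity_rev h]
    by_cases h1 : i = j
    · subst h1
      simp only [h', if_true, if_false]
      linear_combination (1 + parity i * parity i) * h2 + (1 / 2) * h3
    · by_cases h4 : i = j.rev
      · simp only [h4, h, if_true, if_false]
        ring
      · simp [h1, h4]

theorem parityBasis_mul_cancel (M : Matrix (Fin n) (Fin m) ℝ) :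
    parityBasis n * (parityBasis n * M) = M := by
  rw [← Matrix.mul_assoc, parityBasis_mul_self, Matrix.one_mul]

theorem exchange_mul_parityBasis :
    exchange n * parityBasis n = parityBasis n * diagonal parity := by
  ext i j
  rw [mul_parityBasis_apply, mul_diagonal]
  by_cases h : j.rev = j
  · have : parity j = 1 := by simp [parity, h]
    simp [exchange_apply, parityBasis, h, this]
  · have h3 := parity_mul_self j
    simp only [h, exchange_apply, parityBasis, of_apply, if_false, Fin.rev_rev]
    by_cases h1 : i = j
    · subst h1
      have h' : ¬ i = i.rev := fun e => h e.symm
      simp only [h', if_true, if_false]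
      linear_combination -(√2)⁻¹ * h3
    · by_cases h4 : i = j.rev
      · simp only [h4, h, if_true, if_false]
        ring
      · simp [h1, h4]

theorem parityBasis_mul_exchange :
    parityBasis n * exchange n = diagonal parity * parityBasis n := by
  have h := congrArg transpose (exchange_mul_parityBasis (n := n))
  rwa [transpose_mul, transpose_mul, transpose_parityBasis, transpose_exchange,
    diagonal_transpose] at h

theorem norm2_parityBasis_le : norm2 (parityBasis n) ≤ 1 :=
  norm2_le_one_of_transpose_mul_self (by rw [transpose_parityBasis, parityBasis_mul_self])

theorem blockTriangular_parityBasis : (parityBasis n).BlockTriangular level := by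
  intro i j h
  have h1 : i ≠ j := by
    rintro rfl
    exact lt_irrefl _ h
  have h2 : i ≠ j.rev := by
    rintro rfl
    rw [level_rev] at h
    exact lt_irrefl _ h
  simp [parityBasis, h1, h2]

/-- Each basis vector is supported on one pair `{i, i.rev}`, where `d` is constant. This lets the
scaling by `D` survive the change of basis. -/
theorem diagonal_mul_parityBasis {d : Fin n → ℝ} (hd : ∀ i, d i.rev = d i) :
    diagonal d * parityBasis n = parityBasis n * diagonal d := by
  ext i j
  rw [diagonal_mul, mul_diagonal]
  by_cases h1 : i = j
  · subst h1
    ring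
  · by_cases h2 : i = j.rev
    · rw [h2, hd, mul_comm]
    · simp [parityBasis, h1, h2]

/-- The matrix of `M` in the basis of eigenvectors of the exchange matrix. -/
def parityConj (M : Matrix (Fin n) (Fin n) ℝ) : Matrix (Fin n) (Fin n) ℝ :=
  parityBasis n * M * parityBasis n

theorem parityConj_parityConj (M : Matrix (Fin n) (Fin n) ℝ) : parityConj (parityConj M) = M := by
  simp only [parityConj, Matrix.mul_assoc, parityBasis_mul_cancel, parityBasis_mul_self,
    Matrix.mul_one]

theorem parityConj_mul (M N : Matrix (Fin n) (Fin n) ℝ) :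
    parityConj (M * N) = parityConj M * parityConj N := by
  simp only [parityConj, Matrix.mul_assoc, parityBasis_mul_cancel]

theorem parityConj_one : parityConj (1 : Matrix (Fin n) (Fin n) ℝ) = 1 := by
  rw [parityConj, Matrix.mul_one, parityBasis_mul_self]

theorem parityConj_add (M N : Matrix (Fin n) (Fin n) ℝ) :
    parityConj (M + N) = parityConj M + parityConj N := by
  simp only [parityConj, Matrix.mul_add, Matrix.add_mul]

theorem parityConj_sub (M N : Matrix (Fin n) (Fin n) ℝ) :
    parityConj (M - N) = parityConj M - parityConj N := by
  simp only [parityConj, Matrix.mul_sub, Matrix.sub_mul]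

theorem parityConj_transpose (M : Matrix (Fin n) (Fin n) ℝ) :
    parityConj Mᵀ = (parityConj M)ᵀ := by
  simp only [parityConj, transpose_mul, transpose_parityBasis, Matrix.mul_assoc]

theorem isUnit_parityConj {M : Matrix (Fin n) (Fin n) ℝ} (hM : IsUnit M) :
    IsUnit (parityConj M) := by
  have : IsUnit (parityBasis n) := IsUnit.of_mul_eq_one _ parityBasis_mul_self
  exact (this.mul hM).mul this

theorem parityConj_inv (M : Matrix (Fin n) (Fin n) ℝ) : parityConj M⁻¹ = (parityConj M)⁻¹ := by
  have he : (parityBasis n)⁻¹ = parityBasis n := inv_eq_left_inv parityBasis_mul_self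
  simp only [parityConj, Matrix.mul_inv_rev, he, Matrix.mul_assoc]

theorem normF_parityConj_le (M : Matrix (Fin n) (Fin n) ℝ) : normF (parityConj M) ≤ normF M :=
  (normF_mul_le_normF' norm2_parityBasis_le _).trans (normF_mul_le_normF norm2_parityBasis_le _)

theorem norm2_parityConj_le (M : Matrix (Fin n) (Fin n) ℝ) : norm2 (parityConj M) ≤ norm2 M := by
  have h := norm2_parityBasis_le (n := n)
  refine (norm2_mul_le _ _).trans ((mul_le_of_le_one_right (norm2_nonneg _) h).trans ?_)
  exact (norm2_mul_le _ _).trans (mul_le_of_le_one_left (norm2_nonneg _) h)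

theorem isCentrosymmetric_parityConj_iff {M : Matrix (Fin n) (Fin n) ℝ} :
    IsCentrosymmetric (parityConj M) ↔ diagonal parity * M = M * diagonal parity := by
  have e1 : exchange n * parityConj M = parityBasis n * (diagonal parity * M) * parityBasis n := by
    simp only [parityConj, ← Matrix.mul_assoc, exchange_mul_parityBasis]
  have e2 : parityConj M * exchange n = parityBasis n * (M * diagonal parity) * parityBasis n := by
    simp only [parityConj, Matrix.mul_assoc, parityBasis_mul_exchange]
  rw [isCentrosymmetric_iff, e1, e2]
  refine ⟨fun h => ?_, fun h => by rw [h]⟩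
  have h' := congrArg parityConj h
  exact (parityConj_parityConj (diagonal parity * M)).symm.trans
    (h'.trans (parityConj_parityConj (M * diagonal parity)))

/-- Between different levels this is the double-cone shape. Within a pair `{j, j.rev}` the two basis
vectors have opposite parity, and a centrosymmetric matrix, which commutes with the exchange, does
not mix parities. -/
theorem blockTriangular_parityConj {X : Matrix (Fin n) (Fin n) ℝ} (hX : IsCentrosymmetric X)
    (hXd : IsDoubleCone X) : (parityConj X).BlockTriangular levelKey := by
  intro i j h
  rcases lt_or_ge (level j) (level i) with hl | hl
  · exact (blockTriangular_parityBasis.mul (isDoubleCone_iff.1 hXd)).mul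
      blockTriangular_parityBasis hl
  · have hl' : level i = level j := by
      refine hl.antisymm (not_lt.1 fun h' => ?_)
      exact (levelKey_lt h').not_gt h
    have hne : i ≠ j := by
      rintro rfl
      exact lt_irrefl _ h
    have hi : i = j.rev := (eq_or_eq_rev_of_level_eq hl').resolve_left hne
    have hp : parity i = -parity j := by
      rw [hi]
      exact parity_rev (hi ▸ hne)
    rw [← parityConj_parityConj X, isCentrosymmetric_parityConj_iff] at hX
    have h1 := congrFun (congrFun hX i) j
    rw [diagonal_mul, mul_diagonal, hp] at h1
    have h2 := parity_mul_self j
    linear_combination (-1 / 2 * parity j) * h1 - parityConj X i j * h2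

theorem isDoubleCone_parityConj {M : Matrix (Fin n) (Fin n) ℝ}
    (hM : M.BlockTriangular levelKey) : IsDoubleCone (parityConj M) :=
  isDoubleCone_iff.2 ((blockTriangular_parityBasis.mul
    (fun _ _ h => hM (levelKey_lt h))).mul blockTriangular_parityBasis)

theorem parityConj_apply_self {X : Matrix (Fin n) (Fin n) ℝ} (hX : IsCentrosymmetric X)
    (i : Fin n) :
    parityConj X i i = if i.rev = i then X i i else X i i + parity i * X i i.rev := by
  rw [isCentrosymmetric_iff_apply] at hX
  -- Transposing turns the left factor `parityBasis n` into a right one, so the entry formula for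
  -- right multiplication can be used twice.
  have h1 : ∀ j, parityConj X i j = ((X * parityBasis n)ᵀ * parityBasis n) j i := by
    intro j
    rw [parityConj, Matrix.mul_assoc, ← transpose_apply (parityBasis n * _), transpose_mul,
      transpose_parityBasis]
  rw [h1, mul_parityBasis_apply]
  split_ifs with h
  · rw [transpose_apply, mul_parityBasis_apply, if_pos h]
  · rw [transpose_apply, transpose_apply, mul_parityBasis_apply, mul_parityBasis_apply, if_neg h,
      if_neg h, hX, ← hX i.rev i, Fin.rev_rev]
    have h2 := inv_sqrt_two_mul_self
    have h3 := parity_mul_self i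
    linear_combination (parity i * parity i * X i i + 2 * parity i * X i i.rev + X i i) * h2 +
      1 / 2 * X i i * h3

/-- The sum and the difference in `SameSigns` are the diagonal entries at `i` and `i.rev` in the
eigenbasis, in the order given by the parity. At a middle index the sum doubles the entry and the
difference is zero. -/
theorem sameSigns_iff {X Y : Matrix (Fin n) (Fin n) ℝ} (hX : IsCentrosymmetric X)
    (hY : IsCentrosymmetric Y) :
    SameSigns X Y ↔
      ∀ i, SignType.sign (parityConj Y i i) = SignType.sign (parityConj X i i) := by
  simp only [parityConj_apply_self hX, parityConj_apply_self hY]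
  have hs : ∀ x : ℝ, SignType.sign (x + x) = SignType.sign x := fun x => by
    rw [← two_mul, sign_mul, sign_pos two_pos, one_mul]
  constructor
  · intro h i
    have h1 := h i
    split_ifs with hi
    · rw [hi, hs, hs] at h1
      exact h1.1
    · unfold parity
      split_ifs
      · simpa [sub_eq_add_neg] using h1.2
      · simpa using h1.1
  · intro h i
    by_cases hi : i.rev = i
    · have h1 := h i
      rw [if_pos hi, if_pos hi] at h1
      rw [hi, hs, hs, sub_self, sub_self]
      exact ⟨h1, rfl⟩
    · have hi' : ¬ i.rev.rev = i.rev := by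
        rw [Fin.rev_rev]
        exact fun e => hi e.symm
      have h1 := h i
      have h2 := h i.rev
      rw [if_neg hi, if_neg hi] at h1
      rw [if_neg hi', if_neg hi', parity_rev hi, isCentrosymmetric_iff_apply.1 hX,
        isCentrosymmetric_iff_apply.1 hX, isCentrosymmetric_iff_apply.1 hY,
        isCentrosymmetric_iff_apply.1 hY] at h2
      unfold parity at h1 h2
      split_ifs at h1 h2
      · exact ⟨by simpa using h2, by simpa [sub_eq_add_neg] using h1⟩
      · exact ⟨by simpa using h1, by simpa [sub_eq_add_neg] using h2⟩

end Exchange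

/-! ### Gram matrices, double-cone factors and diagonal scalings. -/

theorem mul_inv_of_isUnit {X : Matrix (Fin n) (Fin n) ℝ} (hX : IsUnit X) : X * X⁻¹ = 1 :=
  mul_nonsing_inv _ ((Matrix.isUnit_iff_isUnit_det _).1 hX)

theorem inv_mul_of_isUnit {X : Matrix (Fin n) (Fin n) ℝ} (hX : IsUnit X) : X⁻¹ * X = 1 :=
  nonsing_inv_mul _ ((Matrix.isUnit_iff_isUnit_det _).1 hX)

theorem isUnit_of_rank_eq {X : Matrix (Fin n) (Fin n) ℝ} (hX : X.rank = n) : IsUnit X := by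
  rw [← mulVec_surjective_iff_isUnit]
  have h : LinearMap.range X.mulVecLin = ⊤ := by
    refine Submodule.eq_top_of_finrank_eq ?_
    rw [Module.finrank_fin_fun]
    exact hX
  exact LinearMap.range_eq_top.1 h

theorem pinv_eq_inv {X : Matrix (Fin n) (Fin n) ℝ} (hX : IsUnit X) : pinv X = X⁻¹ := by
  refine (pinv_spec X).unique ⟨?_, ?_, ?_, ?_⟩ <;>
    simp [mul_inv_of_isUnit hX, inv_mul_of_isUnit hX]

/-- Full column rank gives `A† A = 1`. The identity turns `ΔA X⁻¹` into `ΔA A† Q`, to which the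
hypothesis on `‖ΔA A†‖₂` applies. -/
theorem pinv_mul_eq_inv {A Q : Matrix (Fin m) (Fin n) ℝ} {X : Matrix (Fin n) (Fin n) ℝ}
    (hA : A = Q * X) (hQ : Qᵀ * Q = 1) (hX : IsUnit X) : pinv A * Q = X⁻¹ := by
  have h := (pinv_spec A).mul_mul_left
  have h1 : X * (pinv A * A) = X := by
    have h2 := congrArg (Qᵀ * ·) h
    simp only [hA, Matrix.mul_assoc] at h2
    simp only [← Matrix.mul_assoc Qᵀ Q, hQ, Matrix.one_mul] at h2
    simpa only [hA, Matrix.mul_assoc] using h2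
  have h3 : pinv A * A = 1 := by
    rw [← Matrix.one_mul (pinv A * A), ← inv_mul_of_isUnit hX, Matrix.mul_assoc, h1]
  calc pinv A * Q = pinv A * Q * (X * X⁻¹) := by rw [mul_inv_of_isUnit hX, Matrix.mul_one]
    _ = pinv A * A * X⁻¹ := by
      rw [← Matrix.mul_assoc, Matrix.mul_assoc (pinv A) Q X, ← hA]
    _ = X⁻¹ := by rw [h3, Matrix.one_mul]

theorem isColumnPerplecticOrthogonal_of_isCentrosymmetric {Q : Matrix (Fin m) (Fin n) ℝ}
    (hc : IsCentrosymmetric Q) (hQ : Qᵀ * Q = 1) : IsColumnPerplecticOrthogonal Q := by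
  refine ⟨?_, hQ⟩
  rw [Matrix.mul_assoc, isCentrosymmetric_iff.1 hc, ← Matrix.mul_assoc, hQ, Matrix.one_mul]

theorem add_transpose_mul_add {Q K : Matrix (Fin m) (Fin n) ℝ} (hQ : Qᵀ * Q = 1) :
    (Q + K)ᵀ * (Q + K) = 1 + (Qᵀ * K + (Qᵀ * K)ᵀ + Kᵀ * K) := by
  rw [transpose_add, Matrix.add_mul, Matrix.mul_add, Matrix.mul_add, hQ, transpose_mul,
    transpose_transpose]
  abel

/-- A vector `v` killed by `Q + K` satisfies `Qᵀ K v = -v`, which forces `v = 0`. -/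
theorem posDef_gram_add {Q K : Matrix (Fin m) (Fin n) ℝ} (hQ : Qᵀ * Q = 1)
    (hG : norm2 (Qᵀ * K) < 1) : ((Q + K)ᵀ * (Q + K)).PosDef := by
  rw [← conjTranspose_eq_transpose_of_trivial]
  refine PosDef.conjTranspose_mul_self _ ?_
  change Function.Injective (Q + K).mulVecLin
  rw [injective_iff_map_eq_zero]
  intro v hv
  have h1 : (Qᵀ * K) *ᵥ v = -v := by
    have h2 : Qᵀ *ᵥ ((Q + K) *ᵥ v) = 0 := by
      rw [show (Q + K) *ᵥ v = 0 from hv, mulVec_zero]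
    rw [mulVec_mulVec, Matrix.mul_add, hQ, add_mulVec, one_mulVec] at h2
    exact eq_neg_of_add_eq_zero_right h2
  have h2 := sum_mulVec_sq_le (Qᵀ * K) v
  rw [h1] at h2
  simp only [Pi.neg_apply, neg_sq] at h2
  have h3 : 0 ≤ ∑ i, v i ^ 2 := Finset.sum_nonneg fun i _ => sq_nonneg _
  have h4 : norm2 (Qᵀ * K) ^ 2 < 1 := by nlinarith [norm2_nonneg (Qᵀ * K)]
  have h5 : ∑ i, v i ^ 2 = 0 := by nlinarith
  funext i
  rw [Finset.sum_eq_zero_iff_of_nonneg fun i _ => sq_nonneg _] at h5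
  exact pow_eq_zero_iff (two_ne_zero) |>.1 (h5 i (Finset.mem_univ i))

/-- A centrosymmetric positive definite matrix has a centrosymmetric double-cone factor. -/
theorem exists_isDoubleCone_factor {S : Matrix (Fin n) (Fin n) ℝ} (hS : S.PosDef)
    (hc : IsCentrosymmetric S) :
    ∃ L : Matrix (Fin n) (Fin n) ℝ, IsCentrosymmetric L ∧ IsDoubleCone L ∧
      (∀ i, 0 < parityConj L i i) ∧ Lᵀ * L = S := by
  have hU : IsUnit (parityBasis n) := IsUnit.of_mul_eq_one _ parityBasis_mul_self
  have hS' : (parityConj S).PosDef := by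
    have := hS.conjTranspose_mul_mul_same (B := parityBasis n) (mulVec_injective_of_isUnit hU)
    rwa [conjTranspose_eq_transpose_of_trivial, transpose_parityBasis] at this
  obtain ⟨M, hM, hpos, hMS⟩ := exists_cholesky levelKey_injective hS'
  have hu : IsUnit M := isUnit_of_transpose_mul_self hS'.isUnit hMS
  set E : Matrix (Fin n) (Fin n) ℝ := diagonal parity with hE
  have hEE : E * E = 1 := by
    rw [hE, diagonal_mul_diagonal]
    simp only [parity_mul_self]
    exact diagonal_one
  have hES : E * parityConj S = parityConj S * E := by
    rw [← isCentrosymmetric_parityConj_iff, parityConj_parityConj]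
    exact hc
  -- Uniqueness yields symmetry: `E M E` is triangular with the same diagonal and the same Gram
  -- matrix as `M`. Hence `M` commutes with the parities, that is, `parityConj M` is
  -- centrosymmetric.
  have hEM : E * M * E = M := by
    have hEb : E.BlockTriangular levelKey := blockTriangular_diagonal _
    refine cholesky_unique levelKey_injective ((hEb.mul hM).mul hEb) hM hu (fun i => ?_) ?_
    · rw [hE, mul_diagonal, diagonal_mul, mul_right_comm, parity_mul_self, one_mul]
    · have : Eᵀ = E := diagonal_transpose _
      calc (E * M * E)ᵀ * (E * M * E) = E * (Mᵀ * (E * E) * M) * E := by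
            simp only [transpose_mul, this, Matrix.mul_assoc]
        _ = parityConj S := by
            rw [hEE, Matrix.mul_one, hMS, hES, Matrix.mul_assoc, hEE, Matrix.mul_one]
        _ = Mᵀ * M := hMS.symm
  refine ⟨parityConj M, ?_, isDoubleCone_parityConj hM, ?_, ?_⟩
  · rw [isCentrosymmetric_parityConj_iff, ← hE]
    calc E * M = E * M * (E * E) := by rw [hEE, Matrix.mul_one]
      _ = M * E := by rw [← Matrix.mul_assoc, hEM]
  · rwa [parityConj_parityConj]
  · rw [← parityConj_transpose, ← parityConj_mul, hMS, parityConj_parityConj]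

/-- A double-cone factor is determined by its Gram matrix and its sign convention. -/
theorem isDoubleCone_factor_unique {X Y : Matrix (Fin n) (Fin n) ℝ} (hX : IsCentrosymmetric X)
    (hXd : IsDoubleCone X) (hY : IsCentrosymmetric Y) (hYd : IsDoubleCone Y) (hu : IsUnit X)
    (hs : ∀ i, SignType.sign (parityConj Y i i) = SignType.sign (parityConj X i i))
    (h : Yᵀ * Y = Xᵀ * X) : Y = X := by
  rw [← parityConj_parityConj X, ← parityConj_parityConj Y]
  refine congrArg parityConj (cholesky_unique levelKey_injective
    (blockTriangular_parityConj hY hYd) (blockTriangular_parityConj hX hXd)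
    (isUnit_parityConj hu) hs ?_)
  rw [← parityConj_transpose, ← parityConj_transpose, ← parityConj_mul, ← parityConj_mul, h]

theorem normF_factor_sub_one_mul_diagonal_le {L G : Matrix (Fin n) (Fin n) ℝ}
    {K : Matrix (Fin m) (Fin n) ℝ} (hL : IsCentrosymmetric L) (hLd : IsDoubleCone L)
    (hpos : ∀ i, 0 < parityConj L i i) (hu : IsUnit L)
    (hLH : Lᵀ * L = 1 + (G + Gᵀ + Kᵀ * K)) (hK : norm2 K ≤ 1) {d : Fin n → ℝ}
    (hd0 : ∀ i, 0 ≤ d i) (hsym : ∀ i, d i.rev = d i) {c : ℝ} (hc : 0 ≤ c)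
    (hd : ∀ i j, level i ≤ level j → d j ≤ c * d i) :
    normF ((L - 1) * diagonal d) ≤ norm2 L⁻¹ *
      (normF (G * diagonal d) + c * normF (G * diagonal d) + normF (K * diagonal d)) := by
  have hconj : ∀ M : Matrix (Fin n) (Fin n) ℝ,
      parityConj M * diagonal d = parityConj (M * diagonal d) := fun M => by
    rw [parityConj, parityConj, Matrix.mul_assoc _ (parityBasis n), ← diagonal_mul_parityBasis hsym]
    simp only [Matrix.mul_assoc]
  have key := normF_cholesky_sub_one_mul_diagonal_le levelKey_injective
    (L := parityConj L) (G := parityConj G) (K := K * parityBasis n) (d := d) (c := c)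
    (blockTriangular_parityConj hL hLd) hpos (isUnit_parityConj hu) ?_ ?_ hd0 hc ?_
  · rw [← parityConj_one, ← parityConj_sub, hconj, hconj, ← parityConj_inv, Matrix.mul_assoc K,
      ← diagonal_mul_parityBasis hsym, ← Matrix.mul_assoc K] at key
    have h1 := normF_parityConj_le (parityConj ((L - 1) * diagonal d))
    rw [parityConj_parityConj] at h1
    refine h1.trans (key.trans ?_)
    have h2 := normF_parityConj_le (G * diagonal d)
    have h3 := norm2_parityConj_le L⁻¹
    have h4 := normF_mul_le_normF' norm2_parityBasis_le (K * diagonal d)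
    have h5 := normF_nonneg (parityConj (G * diagonal d))
    have h6 := normF_nonneg (K * diagonal d * parityBasis n)
    have h7 := norm2_nonneg L⁻¹
    exact mul_le_mul h3 (add_le_add (add_le_add h2 (mul_le_mul_of_nonneg_left h2 hc)) h4)
      (add_nonneg (add_nonneg h5 (mul_nonneg hc h5)) h6) h7
  · rw [← parityConj_transpose, ← parityConj_mul, hLH, parityConj_add, parityConj_add,
      parityConj_add, parityConj_one, ← parityConj_transpose, parityConj, parityConj, parityConj,
      transpose_mul, transpose_parityBasis]
    simp only [Matrix.mul_assoc]
  · exact (norm2_mul_le _ _).trans (mul_le_one₀ hK (norm2_nonneg _) norm2_parityBasis_le)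
  · intro i j hij
    refine hd i j (not_lt.1 fun h => ?_)
    exact (levelKey_lt h).not_ge hij

/-- Both indices are folded into the first half of the diagonal, where level and position coincide.
The `1` in the maximum accounts for equal levels, a case that `ς_D` leaves out. -/
theorem le_varsigma_mul {D : Matrix (Fin n) (Fin n) ℝ} (hD : D ∈ PosDiag n) {i j : Fin n}
    (hij : level i ≤ level j) : D j j ≤ max 1 (varsigma D) * D i i := by
  obtain ⟨-, hc, hpos⟩ := hD
  rw [isCentrosymmetric_iff_apply] at hc
  have hfold : ∀ i : Fin n, ∃ a : Fin n, a ≤ a.rev ∧ (a : ℕ) = level i ∧ D a a = D i i := by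
    intro i
    rcases le_total i i.rev with h | h
    · exact ⟨i, h, (min_eq_left (Fin.le_def.1 h)).symm, rfl⟩
    · refine ⟨i.rev, by rwa [Fin.rev_rev], (min_eq_right (Fin.le_def.1 h)).symm, hc i i⟩
  obtain ⟨a, -, hai, hDa⟩ := hfold i
  obtain ⟨b, hb, hbj, hDb⟩ := hfold j
  rw [← hDa, ← hDb]
  have ha0 := hpos a
  rcases hij.eq_or_lt with h | h
  · have hab : a = b := Fin.ext (by rw [hai, hbj, h])
    rw [hab]
    exact le_mul_of_one_le_left (hpos b).le (le_max_left _ _)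
  · rw [← div_le_iff₀ ha0]
    have hab : a < b := by
      rw [Fin.lt_def, hai, hbj]
      exact h
    have hmem : D b b / D a a ∈ {r : ℝ | ∃ a b : Fin n, a < b ∧ b ≤ b.rev ∧ r = D b b / D a a} :=
      ⟨a, b, hab, hb, rfl⟩
    refine le_trans (le_csSup ?_ hmem) (le_max_right _ _)
    refine Set.Finite.bddAbove ((Set.finite_range fun p : Fin n × Fin n =>
      D p.2 p.2 / D p.1 p.1).subset ?_)
    rintro r ⟨a, b, -, -, rfl⟩
    exact ⟨(a, b), rfl⟩

theorem norm2_inv_le {L : Matrix (Fin n) (Fin n) ℝ} {Q K : Matrix (Fin m) (Fin n) ℝ}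
    (hQ : Qᵀ * Q = 1)
    (hQL : ((Q + K) * L⁻¹)ᵀ * ((Q + K) * L⁻¹) = 1) :
    norm2 L⁻¹ * (1 - norm2 (Qᵀ * K)) ≤ 1 := by
  -- From `Qᵀ (Q + K) = 1 + Qᵀ K`. The first term has norm at most one, and the second is absorbed
  -- on the left.
  have e : L⁻¹ = Qᵀ * ((Q + K) * L⁻¹) - Qᵀ * K * L⁻¹ := by
    rw [← Matrix.mul_assoc, Matrix.mul_add, hQ, Matrix.add_mul, Matrix.one_mul, add_sub_cancel_right]
  have h1 := norm2_le_one_of_transpose_mul_self hQ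
  have h2 := norm2_le_one_of_transpose_mul_self hQL
  have h3 : norm2 L⁻¹ ≤ 1 + norm2 (Qᵀ * K) * norm2 L⁻¹ := by
    conv_lhs => rw [e]
    refine (norm2_sub_le _ _).trans (add_le_add ?_ (norm2_mul_le _ _))
    refine (norm2_mul_le _ _).trans (mul_le_one₀ ?_ (norm2_nonneg _) h2)
    rwa [norm2_transpose]
  linarith

/-- `‖Q‖₂ = 1` unless `n = 0`, when `B` is empty. The squared norm `‖Qᵀ Q‖₂` treats both cases at
once. -/
theorem normF_le_norm2_mul_normF {Q : Matrix (Fin m) (Fin n) ℝ} (hQ : Qᵀ * Q = 1)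
    (B : Matrix (Fin l) (Fin n) ℝ) : normF B ≤ norm2 Q * normF B := by
  have h1 := normF_mul_le' B (1 : Matrix (Fin n) (Fin n) ℝ)
  rw [Matrix.mul_one, ← hQ, norm2_transpose_mul_self] at h1
  have h2 := norm2_le_one_of_transpose_mul_self hQ
  have h3 := mul_le_mul_of_nonneg_left h2 (norm2_nonneg Q)
  nlinarith [normF_nonneg B]

theorem PosDiag.eq_diagonal {D : Matrix (Fin n) (Fin n) ℝ} (hD : D ∈ PosDiag n) :
    D = diagonal fun i => D i i :=
  hD.1.diagonal_diag.symm

theorem PosDiag.isUnit {D : Matrix (Fin n) (Fin n) ℝ} (hD : D ∈ PosDiag n) : IsUnit D := by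
  rw [PosDiag.eq_diagonal hD, isUnit_diagonal, Pi.isUnit_iff]
  exact fun i => (hD.2.2 i).ne'.isUnit

theorem one_mem_posDiag : (1 : Matrix (Fin n) (Fin n) ℝ) ∈ PosDiag n := by
  refine ⟨isDiag_one, ?_, fun i => by simp⟩
  rw [IsCentrosymmetric, Matrix.mul_one, exchange_mul_self]

/-- The terms `G`, `Gᵀ` and `Kᵀ K` contribute `1`, `max 1 s` and `1`, while `‖L⁻¹‖₂ ≤ 1 / (2 -
√(3/2))`. The left side is at most `3 √(1 + s²)`. -/
theorem two_add_max_le (s : ℝ) :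
    2 + max 1 s ≤ (√6 + √3) * (2 - √(3 / 2)) * √(1 + s ^ 2) := by
  have h6 : 2.4 ≤ √6 := Real.le_sqrt_of_sq_le (by norm_num)
  have h3 : 1.7 ≤ √3 := Real.le_sqrt_of_sq_le (by norm_num)
  have h32 : √(3 / 2) ≤ 1.225 := Real.sqrt_le_iff.2 (by norm_num)
  have h : 3 ≤ (√6 + √3) * (2 - √(3 / 2)) := by nlinarith
  have h1 : 1 ≤ √(1 + s ^ 2) := Real.le_sqrt_of_sq_le (by nlinarith [sq_nonneg s])
  have hs : s ≤ √(1 + s ^ 2) := Real.le_sqrt_of_sq_le (by linarith)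
  have hm : max 1 s ≤ √(1 + s ^ 2) := max_le h1 hs
  nlinarith

end QXFactorization

end

/-! ### The perturbation theorem. -/

open QXFactorization in
theorem theorem2p1 {m n : ℕ}
    (A Q : Matrix (Fin m) (Fin n) ℝ) (X : Matrix (Fin n) (Fin n) ℝ)
    (hA : QXFactorization.IsCentrosymmetric A)
    (hrank : A.rank = n)
    (hQX : QXFactorization.IsQX A Q X)
    (ΔA : Matrix (Fin m) (Fin n) ℝ)
    (hΔA : QXFactorization.IsCentrosymmetric ΔA)
    (hpinv : QXFactorization.norm2 (ΔA * QXFactorization.pinv A) < 1)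
    (hsmall : QXFactorization.normF (Qᵀ * ΔA * X⁻¹) ≤ √(3 / 2) - 1) :
    ∃ (ΔQ : Matrix (Fin m) (Fin n) ℝ) (ΔX : Matrix (Fin n) (Fin n) ℝ),
      (QXFactorization.IsQX (A + ΔA) (Q + ΔQ) (X + ΔX) ∧
        QXFactorization.SameSigns X (X + ΔX)) ∧
      (∀ (Q' : Matrix (Fin m) (Fin n) ℝ) (X' : Matrix (Fin n) (Fin n) ℝ),
        QXFactorization.IsQX (A + ΔA) Q' X' → QXFactorization.SameSigns X X' →
          Q' = Q + ΔQ ∧ X' = X + ΔX) ∧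
      QXFactorization.normF ΔX ≤
        (√6 + √3) *
          (⨅ D : QXFactorization.PosDiag n,
            √(1 + QXFactorization.varsigma D.1 ^ 2) * QXFactorization.kappa2 (D.1⁻¹ * X)) *
          QXFactorization.norm2 Q * QXFactorization.normF ΔA ∧
      QXFactorization.normF ΔQ ≤
        (2 * √2 + 2) *
          (⨅ D : QXFactorization.PosDiag n,
            QXFactorization.norm2 (Q * D.1⁻¹) * QXFactorization.norm2 (X⁻¹ * D.1)) *
          QXFactorization.norm2 Q * QXFactorization.normF ΔA +
        (2 * √3 + √6) * QXFactorization.normF (Qᵀ * ΔA * X⁻¹) := by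
  obtain ⟨hAQX, ⟨-, hQ⟩, hXc, hXd⟩ := hQX
  have hXu : IsUnit X := by
    refine isUnit_of_rank_eq (le_antisymm X.rank_le_width ?_)
    calc n = A.rank := hrank.symm
      _ ≤ X.rank := by rw [hAQX]; exact Matrix.rank_mul_le_right Q X
  have hQn := norm2_le_one_of_transpose_mul_self hQ
  obtain ⟨K, hKdef⟩ : ∃ K, K = ΔA * X⁻¹ := ⟨_, rfl⟩
  obtain ⟨G, hG⟩ : ∃ G, G = Qᵀ * K := ⟨_, rfl⟩
  have hGe : Qᵀ * ΔA * X⁻¹ = G := by rw [hG, hKdef, Matrix.mul_assoc]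
  rw [hGe] at hsmall ⊢
  have h32 : √(3 / 2) ≤ 1.225 := Real.sqrt_le_iff.2 (by norm_num)
  have hG2 : norm2 G ≤ √(3 / 2) - 1 := (norm2_le_normF G).trans hsmall
  have hK : norm2 K ≤ 1 := by
    rw [hKdef, ← pinv_mul_eq_inv hAQX hQ hXu, ← Matrix.mul_assoc]
    exact (norm2_mul_le _ _).trans (mul_le_one₀ hpinv.le (norm2_nonneg _) hQn)
  have hKX : K * X = ΔA := by
    rw [hKdef, Matrix.mul_assoc, inv_mul_of_isUnit hXu, Matrix.mul_one]
  have hQK : (Q + K) * X = A + ΔA := by rw [Matrix.add_mul, hKX, ← hAQX]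
  have hQKc : IsCentrosymmetric (Q + K) := by
    have h1 : Q + K = (A + ΔA) * X⁻¹ := by
      rw [← hQK, Matrix.mul_assoc, mul_inv_of_isUnit hXu, Matrix.mul_one]
    rw [h1]
    exact (hA.add hΔA).mul hXc.inv
  have hS : ((Q + K)ᵀ * (Q + K)).PosDef :=
    posDef_gram_add hQ (by rw [← hG]; linarith)
  obtain ⟨L, hLc, hLd, hLpos, hLS⟩ := exists_isDoubleCone_factor hS (hQKc.transpose.mul hQKc)
  have hLu : IsUnit L := isUnit_of_transpose_mul_self hS.isUnit hLS
  have hQt : ((Q + K) * L⁻¹)ᵀ * ((Q + K) * L⁻¹) = 1 := by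
    have h1 : L⁻¹ᵀ * Lᵀ = 1 := by
      rw [← Matrix.transpose_mul, mul_inv_of_isUnit hLu, Matrix.transpose_one]
    rw [Matrix.transpose_mul, Matrix.mul_assoc, ← Matrix.mul_assoc (Q + K)ᵀ, ← hLS,
      Matrix.mul_assoc, ← Matrix.mul_assoc, h1, Matrix.one_mul, mul_inv_of_isUnit hLu]
  have hfac : A + ΔA = (Q + K) * L⁻¹ * (L * X) := by
    rw [Matrix.mul_assoc, ← Matrix.mul_assoc L⁻¹, inv_mul_of_isUnit hLu, Matrix.one_mul, hQK]
  have hLXc : IsCentrosymmetric (L * X) := hLc.mul hXc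
  have hLXd : IsDoubleCone (L * X) :=
    isDoubleCone_iff.2 ((isDoubleCone_iff.1 hLd).mul (isDoubleCone_iff.1 hXd))
  have hsign : ∀ i, SignType.sign (parityConj (L * X) i i) =
      SignType.sign (parityConj X i i) := fun i => by
    rw [parityConj_mul, BlockTriangular.mul_apply_self levelKey_injective
      (blockTriangular_parityConj hLc hLd) (blockTriangular_parityConj hXc hXd), sign_mul,
      sign_pos (hLpos i), one_mul]
  have hLH : Lᵀ * L = 1 + (G + Gᵀ + Kᵀ * K) := by rw [hLS, add_transpose_mul_add hQ, hG]
  -- Here `1 - ‖G‖₂ ≥ 2 - √(3/2)` by the smallness hypothesis.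
  have hLi : norm2 L⁻¹ * (2 - √(3 / 2)) ≤ 1 := by
    have h1 := norm2_inv_le hQ hQt
    rw [← hG] at h1
    nlinarith [norm2_nonneg L⁻¹]
  have hGK : ∀ B : Matrix (Fin n) (Fin n) ℝ, normF (G * B) ≤ normF (K * B) := fun B => by
    rw [hG, Matrix.mul_assoc]
    exact normF_mul_le_normF (by rwa [norm2_transpose]) _
  have hLi0 := norm2_nonneg L⁻¹
  have hΔ0 := normF_nonneg ΔA
  have hΔQ := normF_le_norm2_mul_normF hQ ΔA
  have hq0 := norm2_nonneg Q
  have : Nonempty (PosDiag n) := ⟨⟨1, one_mem_posDiag⟩⟩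
  -- Each bound is proved for every single `D`; the factors independent of `D` are gathered in `c`.
  have hinf : ∀ (f : PosDiag n → ℝ) (x c : ℝ), 0 ≤ c → (∀ D, x ≤ f D * c) →
      x ≤ (⨅ D, f D) * c := fun f x c hc h => by
    rw [Real.iInf_mul_of_nonneg hc]
    exact le_ciInf h
  refine ⟨(Q + K) * L⁻¹ - Q, L * X - X, ?_, ?_, ?_, ?_⟩
  · rw [add_sub_cancel, add_sub_cancel]
    exact ⟨⟨hfac, isColumnPerplecticOrthogonal_of_isCentrosymmetric (hQKc.mul hLc.inv) hQt, hLXc,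
      hLXd⟩, (sameSigns_iff hXc hLXc).2 hsign⟩
  · rintro Q' X' ⟨hfac', ⟨-, hQ'⟩, hXc', hXd'⟩ hs
    rw [add_sub_cancel, add_sub_cancel]
    have gram : ∀ (P : Matrix (Fin m) (Fin n) ℝ) (Y : Matrix (Fin n) (Fin n) ℝ), Pᵀ * P = 1 →
        (P * Y)ᵀ * (P * Y) = Yᵀ * Y := fun P Y hP => by
      rw [Matrix.transpose_mul, Matrix.mul_assoc, ← Matrix.mul_assoc Pᵀ, hP, Matrix.one_mul]
    -- Both triangular factors have the Gram matrix of `A + ΔA`.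
    have hX' : X' = L * X := by
      refine isDoubleCone_factor_unique hLXc hLXd hXc' hXd' (hLu.mul hXu) (fun i => ?_) ?_
      · rw [hsign, (sameSigns_iff hXc hXc').1 hs]
      · rw [← gram _ _ hQ', ← gram _ _ hQt, ← hfac, hfac']
    refine ⟨?_, hX'⟩
    have h1 := (mul_inv_of_isUnit (hLu.mul hXu))
    calc Q' = Q' * X' * (L * X)⁻¹ := by rw [hX', Matrix.mul_assoc, h1, Matrix.mul_one]
      _ = (Q + K) * L⁻¹ * (L * X) * (L * X)⁻¹ := by rw [← hfac', hfac]
      _ = (Q + K) * L⁻¹ := by rw [Matrix.mul_assoc, h1, Matrix.mul_one]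
  · refine (hinf _ _ ((√6 + √3) * (norm2 Q * normF ΔA)) (by positivity) fun D => ?_).trans_eq
      (by ring)
    obtain ⟨D, hD⟩ := D
    have hDu := PosDiag.isUnit hD
    have hDX : (D⁻¹ * X)⁻¹ = X⁻¹ * D := by
      rw [Matrix.mul_inv_rev, Matrix.nonsing_inv_nonsing_inv _
        ((Matrix.isUnit_iff_isUnit_det _).1 hDu)]
    have hDXu : IsUnit (D⁻¹ * X) := (Matrix.isUnit_nonsing_inv_iff.2 hDu).mul hXu
    have hW := normF_factor_sub_one_mul_diagonal_le hLc hLd hLpos hLu hLH hK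
      (d := fun i => D i i) (c := max 1 (varsigma D)) (fun i => (hD.2.2 i).le)
      (fun i => isCentrosymmetric_iff_apply.1 hD.2.1 i i)
      (zero_le_one.trans (le_max_left _ _)) fun i j => le_varsigma_mul hD
    rw [← PosDiag.eq_diagonal hD] at hW
    have hKD : normF (K * D) ≤ normF ΔA * norm2 (X⁻¹ * D) := by
      rw [hKdef, Matrix.mul_assoc]
      exact normF_mul_le' _ _
    have hc : 0 ≤ max 1 (varsigma D) := zero_le_one.trans (le_max_left _ _)
    have hs := two_add_max_le (varsigma D)
    have hk0 := normF_nonneg (K * D)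
    -- `D` is inserted so that the column scaling falls on `L - 1` and `D⁻¹ X` is left for the
    -- condition number.
    have e : L * X - X = (L - 1) * D * (D⁻¹ * X) := by
      rw [Matrix.mul_assoc, ← Matrix.mul_assoc D, mul_inv_of_isUnit hDu, Matrix.one_mul,
        Matrix.sub_mul, Matrix.one_mul]
    have h1 : normF ((L - 1) * D) ≤ (√6 + √3) * √(1 + varsigma D ^ 2) * normF (K * D) := by
      have h2 : norm2 L⁻¹ * (2 + max 1 (varsigma D)) ≤ (√6 + √3) * √(1 + varsigma D ^ 2) := by
        have h3 := mul_le_mul_of_nonneg_left hs hLi0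
        have h4 := mul_le_mul_of_nonneg_left hLi
          (show 0 ≤ (√6 + √3) * √(1 + varsigma D ^ 2) by positivity)
        linarith
      calc normF ((L - 1) * D) ≤ norm2 L⁻¹ * (normF (K * D) +
            max 1 (varsigma D) * normF (K * D) + normF (K * D)) := by
            refine hW.trans (mul_le_mul_of_nonneg_left ?_ hLi0)
            exact add_le_add (add_le_add (hGK D) (mul_le_mul_of_nonneg_left (hGK D) hc)) le_rfl
        _ = norm2 L⁻¹ * (2 + max 1 (varsigma D)) * normF (K * D) := by ring
        _ ≤ _ := mul_le_mul_of_nonneg_right h2 hk0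
    rw [e, kappa2, pinv_eq_inv hDXu, hDX]
    have hx0 := norm2_nonneg (D⁻¹ * X)
    have hy0 := norm2_nonneg (X⁻¹ * D)
    calc normF ((L - 1) * D * (D⁻¹ * X)) ≤ normF ((L - 1) * D) * norm2 (D⁻¹ * X) :=
          normF_mul_le' _ _
      _ ≤ (√6 + √3) * √(1 + varsigma D ^ 2) *
            (norm2 Q * normF ΔA * norm2 (X⁻¹ * D)) * norm2 (D⁻¹ * X) := by
          refine mul_le_mul_of_nonneg_right (h1.trans ?_) hx0
          refine mul_le_mul_of_nonneg_left (hKD.trans ?_) (by positivity)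
          exact mul_le_mul_of_nonneg_right hΔQ hy0
      _ = _ := by ring
  · rw [← sub_le_iff_le_add]
    refine (hinf _ _ ((2 * √2 + 2) * (norm2 Q * normF ΔA)) (by positivity) fun D => ?_).trans_eq
      (by ring)
    obtain ⟨D, hD⟩ := D
    have hDu := PosDiag.isUnit hD
    -- No scaling is needed for `L - 1` here; `D` enters only through the bound on `‖X⁻¹‖₂`.
    have hW := normF_factor_sub_one_mul_diagonal_le hLc hLd hLpos hLu hLH hK
      (d := fun _ => 1) (c := 1) (fun _ => zero_le_one) (fun _ => rfl) zero_le_one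
      (fun _ _ _ => (mul_one 1).ge)
    rw [Matrix.diagonal_one, Matrix.mul_one, Matrix.mul_one, Matrix.mul_one] at hW
    have hXi : norm2 X⁻¹ ≤ norm2 (Q * D⁻¹) * norm2 (X⁻¹ * D) := by
      have h1 : X⁻¹ = X⁻¹ * D * (Qᵀ * (Q * D⁻¹)) := by
        rw [← Matrix.mul_assoc Qᵀ, hQ, Matrix.one_mul, Matrix.mul_assoc, mul_inv_of_isUnit hDu,
          Matrix.mul_one]
      have h2 : norm2 (Qᵀ * (Q * D⁻¹)) ≤ norm2 (Q * D⁻¹) := by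
        refine (norm2_mul_le _ _).trans (mul_le_of_le_one_left (norm2_nonneg _) ?_)
        rwa [norm2_transpose]
      calc norm2 X⁻¹ ≤ norm2 (X⁻¹ * D) * norm2 (Qᵀ * (Q * D⁻¹)) := by
            conv_lhs => rw [h1]
            exact norm2_mul_le _ _
        _ ≤ norm2 (X⁻¹ * D) * norm2 (Q * D⁻¹) :=
            mul_le_mul_of_nonneg_left h2 (norm2_nonneg _)
        _ = _ := mul_comm _ _
    have hKF : normF K ≤ norm2 Q * normF ΔA * (norm2 (Q * D⁻¹) * norm2 (X⁻¹ * D)) := by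
      rw [hKdef]
      exact (normF_mul_le' _ _).trans (mul_le_mul hΔQ hXi (norm2_nonneg _) (by positivity))
    have e : (Q + K) * L⁻¹ - Q = (K - Q * (L - 1)) * L⁻¹ := by
      rw [Matrix.mul_sub, Matrix.mul_one, Matrix.sub_mul, Matrix.sub_mul, Matrix.mul_assoc Q L,
        mul_inv_of_isUnit hLu, Matrix.mul_one, Matrix.add_mul]
      abel
    -- `1 / (2 - 1.225) < 1.3`.
    have ht : norm2 L⁻¹ ≤ 1.3 := by nlinarith
    have hk0 := normF_nonneg K
    have hg0 := normF_nonneg G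
    have hW' : normF (L - 1) ≤ 1.3 * (2 * normF G + normF K) := by
      refine hW.trans ((mul_le_mul_of_nonneg_right ht (by positivity)).trans_eq (by ring))
    have h1 : normF ((Q + K) * L⁻¹ - Q) ≤
        (normF K + 1.3 * (2 * normF G + normF K)) * 1.3 := by
      rw [e]
      refine (normF_mul_le' _ _).trans (mul_le_mul ?_ ht hLi0 (by positivity))
      exact (normF_sub_le _ _).trans
        (add_le_add le_rfl ((normF_mul_le_normF hQn _).trans hW'))
    have h2 : 1 ≤ √2 := Real.le_sqrt_of_sq_le (by norm_num)
    have h3 : 1 ≤ √3 := Real.le_sqrt_of_sq_le (by norm_num)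
    have h6 : 2 ≤ √6 := Real.le_sqrt_of_sq_le (by norm_num)
    -- The coefficients obtained are `1.3 * 2.3 = 2.99` for `‖K‖_F` and `1.3 * 2.6 = 3.38` for
    -- `‖G‖_F`; both constants claimed are at least `4`.
    have h4 : normF ((Q + K) * L⁻¹ - Q) - (2 * √3 + √6) * normF G ≤ (2 * √2 + 2) * normF K := by
      nlinarith
    refine h4.trans ((mul_le_mul_of_nonneg_left hKF (by positivity)).trans_eq (by ring))
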